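/- Let $\mathsf{P\Lambda}$ be the $\mathbb{Q}$-algebra of polysymmetric functions: the formal power series over $\mathbb{Q}$ in variables $x_{d,j}$ ($d,j\ge 1$, with $x_{d,j}$ of degree $d$) that have bounded degree and that, for each fixed $d$, are invariant under every permutation of the variables $x_{d,1},x_{d,2},\dots$. A stack $d^m$ is a pair of positive integers $(d,m)$; a stack partition is a finite multiset (written as a weakly decreasing sequence) of stacks $\tau=(d_1^{m_1},\dots,d_s^{m_s})$. Put $\ell(\tau)=s$, $|\tau|=\sum_i d_im_i$ and $\operatorname{sgn}(\tau)=(-1)^{m_1+\cdots+m_s}$. Let $M_\tau$ be the sum, each with coefficient $1$, of all distinct monomials $x_{d_1,\alpha_1}^{m_1}\cdots x_{d_s,\alpha_s}^{m_s}$ with pairwise distinct variables $x_{d_i,\alpha_i}$. For $d\ge1$ define $$E^+_d=\sum_{\substack{|\alpha|=d\\ \text{all multiplicities }1}}M_\alpha,\qquad H^+_d=\sum_{|\alpha|=d}\operatorname{sgn}(\alpha)M_\alpha,\qquad P_d=\sum_{k\mid d}k\,M_{(k^{d/k})}.$$ For $F\in\{E^+,H^+,P\}$ and $m\ge 1$ let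 $F_{d^m}$ be obtained from $F_d$ by replacing every variable $x_{i,j}$ by $x_{i,j}^m$, and put $P_\tau=\prod_{i=1}^{s}P_{d_i^{m_i}}$. Theorem. There is exactly one ring endomorphism $\Omega$ of $\mathsf{P\Lambda}$ with $\Omega(E^+_{d^m})=H^+_{d^m}$ for all $d,m\ge1$. It is an involution, and for every stack partition $\tau$, $$\Omega(P_\tau)=(-1)^{\ell(\tau)}P_\tau .$$ -/

import Mathlib

namespace PolySym

/-- The indeterminates `x_{d,j}`: the pair `(d, j)` has degree `d`, and for each `d ≥ 1` there is one
variable for each `j` in a countably infinite index set (here `ℕ`). -/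
abbrev Var : Type := ℕ+ × ℕ

/-- Formal power series over `ℚ` in the indeterminates `x_{d,j}`. -/
abbrev Series : Type := MvPowerSeries Var ℚ

/-- The degree of the monomial `x^a`, where `x_{d,j}` has degree `d`. -/
noncomputable def monomialDegree (a : Var →₀ ℕ) : ℕ :=
  Finsupp.weight (fun v : Var => (v.1 : ℕ)) a

/-- `f` is a formal sum of monomials of bounded degree. -/
def BoundedDegree (f : Series) : Prop :=
  ∃ N : ℕ, ∀ a : Var →₀ ℕ, N < monomialDegree a → MvPowerSeries.coeff a f = 0

/-- For each fixed `d`, `f` is unchanged by every permutation of the variables `x_{d,1}, x_{d,2}, …`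
(the permutation `Equiv.Perm.prodExtendRight d π` sends `x_{d,j}` to `x_{d,π j}` and fixes all
other variables). -/
def IsPolysymmetric (f : Series) : Prop :=
  ∀ (d : ℕ+) (π : Equiv.Perm ℕ),
    MvPowerSeries.renameEquiv ℚ (Equiv.Perm.prodExtendRight d π) f = f

theorem monomialDegree_add (a b : Var →₀ ℕ) :
    monomialDegree (a + b) = monomialDegree a + monomialDegree b := by
  simp [monomialDegree]

theorem monomialDegree_smul (m : ℕ) (a : Var →₀ ℕ) :
    monomialDegree (m • a) = m * monomialDegree a := by
  simp [monomialDegree]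

theorem coeff_renameEquiv (e : Equiv.Perm Var) (f : Series) (a : Var →₀ ℕ) :
    MvPowerSeries.coeff (a.embDomain e.toEmbedding) (MvPowerSeries.renameEquiv ℚ e f)
      = MvPowerSeries.coeff a f :=
  MvPowerSeries.coeff_embDomain_rename e.toEmbedding f a

theorem renameEquiv_eq_self_iff (e : Equiv.Perm Var) (f : Series) :
    MvPowerSeries.renameEquiv ℚ e f = f ↔
      ∀ a : Var →₀ ℕ, MvPowerSeries.coeff (a.embDomain e.toEmbedding) f
        = MvPowerSeries.coeff a f := by
  constructor
  · intro h a
    conv_lhs => rw [← h]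
    exact coeff_renameEquiv e f a
  · intro h
    ext b
    obtain ⟨a, rfl⟩ : ∃ a : Var →₀ ℕ, a.embDomain e.toEmbedding = b := by
      refine ⟨b.embDomain e.symm.toEmbedding, ?_⟩
      ext v
      obtain ⟨w, rfl⟩ := e.surjective v
      have h1 := Finsupp.embDomain_apply_self e.toEmbedding (b.embDomain e.symm.toEmbedding) w
      have h2 := Finsupp.embDomain_apply_self e.symm.toEmbedding b (e w)
      simp only [Equiv.coe_toEmbedding, Equiv.symm_apply_apply] at h1 h2
      rw [h1, h2]
    rw [coeff_renameEquiv, h]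

/-- The `ℚ`-algebra `PΛ` of polysymmetric functions. -/
noncomputable def PLambda : Subalgebra ℚ Series where
  carrier := {f | BoundedDegree f ∧ IsPolysymmetric f}
  mul_mem' := by
    rintro f g ⟨⟨N, hN⟩, hf⟩ ⟨⟨K, hK⟩, hg⟩
    refine ⟨⟨N + K, fun a ha => ?_⟩, fun d π => by rw [map_mul, hf, hg]⟩
    classical
    rw [MvPowerSeries.coeff_mul]
    refine Finset.sum_eq_zero fun p hp => ?_
    rw [Finset.HasAntidiagonal.mem_antidiagonal] at hp
    rw [← hp, monomialDegree_add] at ha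
    rcases lt_or_ge N (monomialDegree p.1) with h | h
    · rw [hN _ h, zero_mul]
    · rw [hK _ (by omega), mul_zero]
  add_mem' := by
    rintro f g ⟨⟨N, hN⟩, hf⟩ ⟨⟨K, hK⟩, hg⟩
    refine ⟨⟨N + K, fun a ha => ?_⟩, fun d π => by rw [map_add, hf, hg]⟩
    rw [map_add, hN _ (by omega), hK _ (by omega), add_zero]
  algebraMap_mem' := by
    intro r
    refine ⟨⟨0, fun a ha => ?_⟩, fun d π => AlgEquiv.commutes _ r⟩
    classical
    have h0 : a ≠ 0 := by
      rintro rfl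
      simp [monomialDegree] at ha
    rw [MvPowerSeries.algebraMap_apply, MvPowerSeries.coeff_C, if_neg h0]

/-- A stack `d^m`, the pair `(d, m)` of positive integers with degree `d` and multiplicity `m`. -/
abbrev Stack : Type := ℕ+ × ℕ+

/-- A stack partition. A weakly decreasing finite sequence for a total order is the same thing as
a finite multiset. -/
abbrev StackPartition : Type := Multiset Stack

namespace StackPartition

/-- `|τ| = d₁ m₁ + ⋯ + d_s m_s`; thus `τ` is a stack partition of `n` when `τ.size = n`. -/
def size (τ : StackPartition) : ℕ := (τ.map fun s => (s.1 : ℕ) * (s.2 : ℕ)).sum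

/-- The length `ℓ(τ)`, the number of stacks in `τ`. -/
def length (τ : StackPartition) : ℕ := Multiset.card τ

/-- `area(τ) = m₁ + ⋯ + m_s`. -/
def area (τ : StackPartition) : ℕ := (τ.map fun s => (s.2 : ℕ)).sum

/-- `sgn(τ) = (-1)^{area(τ)}`. -/
def sgn (τ : StackPartition) : ℚ := (-1) ^ area τ

/-- `τ` is an ordinary partition: all of its stacks have multiplicity `1`. -/
def IsOrdinary (τ : StackPartition) : Prop := ∀ s ∈ τ, s.2 = 1

theorem le_size {τ : StackPartition} {s : Stack} (hs : s ∈ τ) :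
    (s.1 : ℕ) * (s.2 : ℕ) ≤ size τ :=
  Multiset.single_le_sum (fun _ _ => Nat.zero_le _) _
    (Multiset.mem_map_of_mem (fun s : Stack => (s.1 : ℕ) * (s.2 : ℕ)) hs)

theorem length_le_size (τ : StackPartition) : length τ ≤ size τ := by
  induction τ using Multiset.induction_on with
  | empty => simp [length, size]
  | cons s τ ih =>
    have h : 0 < (s.1 : ℕ) * (s.2 : ℕ) := Nat.mul_pos s.1.pos s.2.pos
    simp only [length, size, Multiset.card_cons, Multiset.map_cons, Multiset.sum_cons] at ih ⊢
    omega

theorem finite_setOf_size_eq (n : ℕ) : {τ : StackPartition | size τ = n}.Finite := by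
  classical
  rcases Nat.eq_zero_or_pos n with rfl | hn
  · refine (Set.finite_singleton (0 : StackPartition)).subset fun τ hτ => ?_
    have h := length_le_size τ
    rw [Set.mem_ofPred_eq] at hτ
    rw [hτ] at h
    exact Multiset.card_eq_zero.1 (Nat.le_zero.1 h)
  · let b : Finset Stack := Finset.Icc 1 ⟨n, hn⟩ ×ˢ Finset.Icc 1 ⟨n, hn⟩
    refine (Multiset.powerset (n • b.val)).toFinset.finite_toSet.subset fun τ hτ => ?_
    rw [Set.mem_ofPred_eq] at hτ
    rw [Finset.mem_coe, Multiset.mem_toFinset, Multiset.mem_powerset, Multiset.le_iff_count]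
    intro s
    by_cases hs : s ∈ τ
    · have h := le_size hs
      rw [hτ] at h
      have h1 : (s.1 : ℕ) ≤ n := le_trans (Nat.le_mul_of_pos_right _ s.2.pos) h
      have h2 : (s.2 : ℕ) ≤ n := le_trans (Nat.le_mul_of_pos_left _ s.1.pos) h
      have hb : s ∈ b := by
        refine Finset.mem_product.2 ⟨Finset.mem_Icc.2 ⟨one_le, ?_⟩,
          Finset.mem_Icc.2 ⟨one_le, ?_⟩⟩
        · exact PNat.coe_le_coe _ _ |>.1 h1
        · exact PNat.coe_le_coe _ _ |>.1 h2
      rw [Multiset.count_nsmul, Multiset.count_eq_one_of_mem b.nodup hb, mul_one]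
      calc τ.count s ≤ Multiset.card τ := Multiset.count_le_card s τ
        _ ≤ size τ := length_le_size τ
        _ = n := hτ
    · rw [Multiset.count_eq_zero_of_notMem hs]
      exact Nat.zero_le _

end StackPartition

/-- The finite set of all stack partitions of `n`. -/
noncomputable def stackPartitions (n : ℕ) : Finset StackPartition :=
  (StackPartition.finite_setOf_size_eq n).toFinset

open Classical in
/-- The finite set of all ordinary partitions of `n`, as stack partitions. -/
noncomputable def ordinaryPartitions (n : ℕ) : Finset StackPartition :=
  (stackPartitions n).filter StackPartition.IsOrdinary

/-- The monomial `x^a` has type `τ = (d₁^{m₁}, …, d_s^{m_s})`: it is of the form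
`x_{d₁,α₁}^{m₁} ⋯ x_{d_s,α_s}^{m_s}` with pairwise distinct variables `x_{d_i,α_i}`. That is, the
pairs (degree, exponent) of the variables that occur in `x^a` are, with repetitions, the stacks
of `τ`. -/
def HasType (a : Var →₀ ℕ) (τ : StackPartition) : Prop :=
  a.support.val.map (fun v => (v.1, a v)) = τ.map (fun s => (s.1, (s.2 : ℕ)))

open Classical in
/-- The sum of all monomials of type `τ`, as a formal power series. -/
noncomputable def monomialSeries (τ : StackPartition) : Series :=
  fun a => if HasType a τ then 1 else 0

theorem coeff_monomialSeries (τ : StackPartition) (a : Var →₀ ℕ) [Decidable (HasType a τ)] :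
    MvPowerSeries.coeff a (monomialSeries τ) = if HasType a τ then 1 else 0 := by
  simp only [MvPowerSeries.coeff_apply, monomialSeries]
  congr

theorem HasType.monomialDegree_eq {a : Var →₀ ℕ} {τ : StackPartition} (h : HasType a τ) :
    monomialDegree a = τ.size := by
  have h1 := congrArg (fun s : Multiset (ℕ+ × ℕ) =>
    (s.map fun p => (p.1 : ℕ) * p.2).sum) h
  simp only [Multiset.map_map, Function.comp_def] at h1
  rw [StackPartition.size, ← h1, monomialDegree, Finsupp.weight_apply, Finsupp.sum, Finset.sum]
  simp only [smul_eq_mul, mul_comm]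

theorem hasType_embDomain_iff (d : ℕ+) (π : Equiv.Perm ℕ) (a : Var →₀ ℕ) (τ : StackPartition) :
    HasType (a.embDomain (Equiv.Perm.prodExtendRight d π).toEmbedding) τ ↔ HasType a τ := by
  have h : (a.embDomain (Equiv.Perm.prodExtendRight d π).toEmbedding).support.val.map
      (fun v => (v.1, a.embDomain (Equiv.Perm.prodExtendRight d π).toEmbedding v))
      = a.support.val.map (fun v => (v.1, a v)) := by
    rw [Finsupp.support_embDomain, Finset.map_val, Multiset.map_map]
    refine Multiset.map_congr rfl fun v _ => ?_
    have hv := Finsupp.embDomain_apply_self (Equiv.Perm.prodExtendRight d π).toEmbedding a v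
    rw [Equiv.coe_toEmbedding] at hv
    simp only [Function.comp_apply, Equiv.coe_toEmbedding, Equiv.Perm.fst_prodExtendRight, hv]
  unfold HasType
  rw [h]

theorem monomialSeries_mem (τ : StackPartition) : monomialSeries τ ∈ PLambda := by
  classical
  refine ⟨⟨τ.size, fun a ha => ?_⟩, fun d π => ?_⟩
  · rw [coeff_monomialSeries, if_neg]
    intro h
    rw [h.monomialDegree_eq] at ha
    exact lt_irrefl _ ha
  · rw [renameEquiv_eq_self_iff]
    intro a
    rw [coeff_monomialSeries, coeff_monomialSeries, hasType_embDomain_iff]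

/-- The monomial polysymmetric function `M_τ`. -/
noncomputable def M (τ : StackPartition) : PLambda := ⟨monomialSeries τ, monomialSeries_mem τ⟩

theorem expand_mem (m : ℕ+) {f : Series} (hf : f ∈ PLambda) :
    MvPowerSeries.expand (m : ℕ) m.ne_zero f ∈ PLambda := by
  obtain ⟨⟨N, hN⟩, hs⟩ := hf
  refine ⟨⟨m * N, fun a ha => ?_⟩, fun d π => ?_⟩
  · by_cases hdvd : ∀ v, (m : ℕ) ∣ a v
    · choose b hb using hdvd
      obtain ⟨c, rfl⟩ : ∃ c : Var →₀ ℕ, a = (m : ℕ) • c := by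
        refine ⟨a.mapRange (fun k => k / (m : ℕ)) (Nat.zero_div _), ?_⟩
        ext v
        simp [hb v]
      rw [MvPowerSeries.coeff_expand_smul]
      rw [monomialDegree_smul] at ha
      exact hN _ (lt_of_mul_lt_mul_left ha (Nat.zero_le _))
    · push Not at hdvd
      obtain ⟨v, hv⟩ := hdvd
      exact MvPowerSeries.coeff_expand_of_not_dvd _ _ _ hv
  · rw [renameEquiv_eq_self_iff]
    have hs' := (renameEquiv_eq_self_iff _ _).1 (hs d π)
    intro a
    by_cases hdvd : ∀ v, (m : ℕ) ∣ a v
    · choose b hb using hdvd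
      obtain ⟨c, rfl⟩ : ∃ c : Var →₀ ℕ, a = (m : ℕ) • c := by
        refine ⟨a.mapRange (fun k => k / (m : ℕ)) (Nat.zero_div _), ?_⟩
        ext v
        simp [hb v]
      have h : ((m : ℕ) • c).embDomain (Equiv.Perm.prodExtendRight d π).toEmbedding
          = (m : ℕ) • c.embDomain (Equiv.Perm.prodExtendRight d π).toEmbedding := by
        simp only [Finsupp.embDomain_eq_mapDomain, Finsupp.mapDomain_smul]
      rw [h, MvPowerSeries.coeff_expand_smul, MvPowerSeries.coeff_expand_smul, hs']
    · push Not at hdvd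
      obtain ⟨v, hv⟩ := hdvd
      rw [MvPowerSeries.coeff_expand_of_not_dvd _ _ _ hv,
        MvPowerSeries.coeff_expand_of_not_dvd (i := Equiv.Perm.prodExtendRight d π v)]
      have := Finsupp.embDomain_apply_self (Equiv.Perm.prodExtendRight d π).toEmbedding a v
      rw [Equiv.coe_toEmbedding] at this
      rwa [this]

/-- `f(x) ↦ f(x^m)`: every variable `x_{d,j}` is replaced by `x_{d,j}^m`. -/
noncomputable def powerSubst (m : ℕ+) (f : PLambda) : PLambda :=
  ⟨MvPowerSeries.expand (m : ℕ) m.ne_zero (f : Series), expand_mem m f.2⟩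

/-- The unsigned elementary polysymmetric function `E⁺_d`. -/
noncomputable def EPlus (d : ℕ+) : PLambda := ∑ α ∈ ordinaryPartitions d, M α

/-- The signed complete homogeneous polysymmetric function `H⁺_d`. -/
noncomputable def HPlus (d : ℕ+) : PLambda := ∑ α ∈ stackPartitions d, α.sgn • M α

/-- The power polysymmetric function `P_d = ∑_{k ∣ d} k M_{k^{d/k}}`. -/
noncomputable def P (d : ℕ+) : PLambda :=
  ∑ k ∈ (Finset.Icc (1 : ℕ+) d).filter (fun k : ℕ+ => (k : ℕ) ∣ (d : ℕ)),
    ((k : ℕ) : ℚ) • M {(k, PNat.divExact d k)}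

/-- `E⁺_{d^m}(x) = E⁺_d(x^m)`. -/
noncomputable def EPlusStack (s : Stack) : PLambda := powerSubst s.2 (EPlus s.1)

/-- `H⁺_{d^m}(x) = H⁺_d(x^m)`. -/
noncomputable def HPlusStack (s : Stack) : PLambda := powerSubst s.2 (HPlus s.1)

/-- `P_{d^m}(x) = P_d(x^m)`. -/
noncomputable def PStack (s : Stack) : PLambda := powerSubst s.2 (P s.1)

/-- `P_τ = ∏ P_{d_i^{m_i}}`, the product over the stacks of `τ`, with repetitions. -/
noncomputable def PPartition (τ : StackPartition) : PLambda := (τ.map PStack).prod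

/-- The defining property of the ring endomorphism `Ω` of `PΛ`. -/
def IsOmega (Ω : PLambda →+* PLambda) : Prop :=
  ∀ d m : ℕ+, Ω (EPlusStack (d, m)) = HPlusStack (d, m)

end PolySym

namespace PolySym

open Finset

/-! Let p_{d,m} = ∑_j x_{d,j}^m. These power sums generate `PLambda` freely (`adjoin_powerSum`,
`algebraicIndependent_powerSum`): a product of them is a positive multiple of the M_τ of its stacks
plus terms in fewer variables. So a ring endomorphism is determined by its values on the p_{d,m},
and these may be prescribed.

With degree-0 term 1, the E⁺_n sum to ∏_v (1 + x_v) and the H⁺_n to its inverse. Their logarithms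
have opposite expansions in power sums, so negating every p_{d,m} sends E⁺ to H⁺, also after x ↦
x^m. `newton_prodSeries` is the logarithm-free form of this.

Conversely, E⁺_{d^m} is p_{d,m} plus a polynomial in power sums p_{k,·} with k < d, so induction on
d forces any Ω to negate all power sums (`IsOmega.map_powerSum`). Then Ω² = id, and each P_{d^m},
being linear in the power sums, changes sign. -/

/-! ### Types of monomials -/

theorem hasType_injective {a : Var →₀ ℕ} {σ τ : StackPartition} (h₁ : HasType a σ)
    (h₂ : HasType a τ) : σ = τ := by
  have hinj : Function.Injective (fun s : Stack => (s.1, (s.2 : ℕ))) := by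
    rintro ⟨d, m⟩ ⟨d', m'⟩ h
    simp only [Prod.mk.injEq, PNat.coe_inj] at h
    exact Prod.ext h.1 h.2
  exact Multiset.map_injective hinj (h₁.symm.trans h₂)

theorem exists_hasType (a : Var →₀ ℕ) : ∃ τ, HasType a τ := by
  refine ⟨a.support.val.map (fun v => (v.1, (a v).toPNat')), ?_⟩
  rw [HasType, Multiset.map_map]
  refine Multiset.map_congr rfl fun v hv => ?_
  have : 0 < a v := Nat.pos_of_ne_zero (Finsupp.mem_support_iff.1 hv)
  simp [Nat.toPNat'_coe, this]

theorem hasType_zero : HasType 0 0 := by simp [HasType]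

theorem HasType.card_support {a : Var →₀ ℕ} {τ : StackPartition} (h : HasType a τ) :
    #a.support = Multiset.card τ := by
  have := congrArg Multiset.card h
  simpa using this

theorem HasType.add_single {a : Var →₀ ℕ} {τ : StackPartition} (h : HasType a τ) {v : Var}
    (hv : a v = 0) (m : ℕ+) : HasType (a + Finsupp.single v (m : ℕ)) ((v.1, m) ::ₘ τ) := by
  classical
  have hv' : v ∉ a.support := by simpa using hv
  have hd : Disjoint a.support (Finsupp.single v (m : ℕ)).support := by
    rw [Finsupp.support_single _ m.ne_zero]
    simpa using hv
  have hs : (a + Finsupp.single v (m : ℕ)).support = cons v a.support hv' := by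
    rw [Finsupp.support_add_eq hd, Finsupp.support_single _ m.ne_zero, cons_eq_insert,
      union_comm, insert_eq]
  rw [HasType, hs, cons_val, Multiset.map_cons, Multiset.map_cons]
  congr 1
  · simp [hv]
  · rw [← h]
    refine Multiset.map_congr rfl fun w hw => ?_
    have : w ≠ v := fun e => hv' (e ▸ hw)
    simp [Finsupp.single_eq_of_ne this]

theorem exists_monomial_hasType (τ : StackPartition) : ∃ a, HasType a τ := by
  induction τ using Multiset.induction_on with
  | empty => exact ⟨0, hasType_zero⟩
  | cons s τ ih =>
    obtain ⟨a, ha⟩ := ih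
    -- An index used by no variable of `a`, in any degree.
    obtain ⟨v, hv⟩ := Infinite.exists_notMem_finset (a.support.image Prod.snd)
    refine ⟨_, ha.add_single (v := (s.1, v)) ?_ s.2⟩
    by_contra h
    exact hv (mem_image.2 ⟨(s.1, v), Finsupp.mem_support_iff.2 h, rfl⟩)

theorem HasType.card_filter_eq {a b : Var →₀ ℕ} {τ : StackPartition} (ha : HasType a τ)
    (hb : HasType b τ) (d : ℕ+) (k : ℕ) :
    #{v ∈ a.support | v.1 = d ∧ a v = k} = #{v ∈ b.support | v.1 = d ∧ b v = k} := by
  classical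
  have h := congrArg (Multiset.count (d, k)) (ha.trans hb.symm)
  simp only [Multiset.count_map, Prod.mk.injEq] at h
  simp only [card_def, filter_val]
  convert h using 4 <;> simp only [eq_comm]

/-- Both monomials have equally many variables of a given degree and exponent. If `b` has exponent
`b v` at `v` and `a` does not, then `a` must have it at some `w` where `b` does not. Transposing `v`
and `w` in `a` then repairs `v`. -/
theorem HasType.exists_mismatch {a b : Var →₀ ℕ} {τ : StackPartition} (ha : HasType a τ)
    (hb : HasType b τ) (hab : a ≠ b) :
    ∃ v w : Var, w.1 = v.1 ∧ a v ≠ b v ∧ a w = b v ∧ b w ≠ b v := by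
  classical
  obtain ⟨v, hv0, hv⟩ : ∃ v, b v ≠ 0 ∧ a v ≠ b v := by
    by_contra! h
    have hle : b ≤ a := fun v => by
      by_cases h0 : b v = 0
      · simp [h0]
      · exact (h v h0).ge
    have hsub : b.support ⊆ a.support := Finsupp.support_mono hle
    have hs : b.support = a.support :=
      eq_of_subset_of_card_le hsub (by rw [ha.card_support, hb.card_support])
    apply hab
    ext v
    by_cases h0 : b v = 0
    · rw [h0]
      exact Finsupp.notMem_support_iff.1 (hs ▸ Finsupp.notMem_support_iff.2 h0)
    · exact h v h0
  by_contra! hw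
  have hsub : ({w ∈ a.support | w.1 = v.1 ∧ a w = b v} : Finset Var) ⊂
      {w ∈ b.support | w.1 = v.1 ∧ b w = b v} := by
    rw [ssubset_iff_of_subset]
    · exact ⟨v, by simp [hv0], by simp [hv]⟩
    · intro w
      simp only [mem_filter, Finsupp.mem_support_iff]
      rintro ⟨-, h1, h2⟩
      have := hw v w h1 hv h2
      exact ⟨by rwa [this], h1, this⟩
  exact (card_lt_card hsub).ne (ha.card_filter_eq hb _ _)

/-- Induction on the number of variables where `a` and `b` disagree: the transposition from
`exists_mismatch` lowers it, and preserves both the type and the coefficient. -/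
theorem coeff_eq_of_hasType {f : Series} (hf : IsPolysymmetric f) {a b : Var →₀ ℕ}
    {τ : StackPartition} (ha : HasType a τ) (hb : HasType b τ) :
    MvPowerSeries.coeff a f = MvPowerSeries.coeff b f := by
  classical
  induction hn : #{v ∈ a.support ∪ b.support | a v ≠ b v} using Nat.strong_induction_on
    generalizing a with
  | _ n ih =>
  by_cases hab : a = b
  · rw [hab]
  obtain ⟨⟨d, i⟩, ⟨d', j⟩, hd, hv, hwv, hw⟩ := ha.exists_mismatch hb hab
  obtain rfl : d' = d := hd
  let e := Equiv.Perm.prodExtendRight d' (Equiv.swap i j)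
  let a' := a.embDomain e.toEmbedding
  have hi : a' (d', i) = a (d', j) := by
    have := Finsupp.embDomain_apply_self e.toEmbedding a (d', j)
    simpa [e, Equiv.Perm.prodExtendRight_apply_eq] using this
  have hne : ∀ v, v ≠ (d', i) → v ≠ (d', j) → a' v = a v := by
    intro v h1 h2
    have := Finsupp.embDomain_apply_self e.toEmbedding a v
    have hev : e v = v := by
      by_cases hvd : v.1 = d'
      · obtain ⟨d, k⟩ := v
        obtain rfl : d = d' := hvd
        simp only [e, Equiv.Perm.prodExtendRight_apply_eq]
        rw [Equiv.swap_apply_of_ne_of_ne]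
        · rintro rfl; exact h1 rfl
        · rintro rfl; exact h2 rfl
      · exact Equiv.Perm.prodExtendRight_apply_ne _ hvd _
    rw [Equiv.coe_toEmbedding, hev] at this
    exact this
  rw [← (renameEquiv_eq_self_iff e f).1 (hf d' _) a]
  refine ih _ ?_ ((hasType_embDomain_iff d' _ a τ).2 ha) rfl
  rw [← hn]
  have key : ∀ v, a' v ≠ b v → a v ≠ b v := by
    intro v h
    by_cases h1 : v = (d', i)
    · subst h1; exact hv
    by_cases h2 : v = (d', j)
    -- The second variable already disagreed, so the swap creates no new disagreement.
    · subst h2; rw [hwv]; exact hw.symm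
    rwa [← hne v h1 h2]
  have mem : ∀ (x y : Var →₀ ℕ) v, x v ≠ y v → v ∈ x.support ∪ y.support := by
    intro x y v h
    simp only [mem_union, Finsupp.mem_support_iff]
    by_contra! h'
    exact h (h'.1.trans h'.2.symm)
  refine card_lt_card ?_
  rw [ssubset_iff_of_subset]
  · refine ⟨(d', i), ?_, ?_⟩
    · exact mem_filter.2 ⟨mem _ _ _ hv, hv⟩
    · intro h
      exact (mem_filter.1 h).2 (hi.trans hwv)
  · intro v h
    have := key v (mem_filter.1 h).2
    exact mem_filter.2 ⟨mem _ _ _ this, this⟩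

/-! ### The power sums are free generators -/

/-- The power sum `∑_j x_{d,j}^m` attached to the stack `d^m`. -/
noncomputable def powerSum (s : Stack) : PLambda := M {s}

theorem hasType_singleton_iff {a : Var →₀ ℕ} {s : Stack} :
    HasType a {s} ↔ ∃ v : Var, v.1 = s.1 ∧ a = Finsupp.single v (s.2 : ℕ) := by
  constructor
  · intro h
    rw [HasType, Multiset.map_singleton, Multiset.map_eq_singleton] at h
    obtain ⟨v, hv, h2⟩ := h
    simp only [Prod.mk.injEq] at h2
    refine ⟨v, h2.1, ?_⟩
    have hs : a.support = {v} := val_injective hv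
    rw [← h2.2]
    exact Finsupp.support_subset_singleton.1 hs.subset
  · rintro ⟨v, hv, rfl⟩
    rw [HasType, Finsupp.support_single _ s.2.ne_zero]
    simp [hv]

theorem coeff_powerSum_mul (s : Stack) (f : Series) (a : Var →₀ ℕ) :
    MvPowerSeries.coeff a ((powerSum s : Series) * f) =
      ∑ v ∈ a.support with v.1 = s.1 ∧ (s.2 : ℕ) ≤ a v,
        MvPowerSeries.coeff (a - Finsupp.single v (s.2 : ℕ)) f := by
  classical
  set S := {v ∈ a.support | v.1 = s.1 ∧ (s.2 : ℕ) ≤ a v} with hS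
  let φ : Var → (Var →₀ ℕ) × (Var →₀ ℕ) :=
    fun v => (Finsupp.single v (s.2 : ℕ), a - Finsupp.single v (s.2 : ℕ))
  have hφ : Function.Injective φ := fun v w h =>
    Finsupp.single_left_injective s.2.ne_zero (Prod.ext_iff.1 h).1
  have hle : ∀ v, (s.2 : ℕ) ≤ a v → Finsupp.single v (s.2 : ℕ) ≤ a := fun v hv =>
    Finsupp.single_le_iff.2 hv
  have hsub : S.image φ ⊆ antidiagonal a := by
    intro x hx
    obtain ⟨v, hv, rfl⟩ := mem_image.1 hx
    rw [HasAntidiagonal.mem_antidiagonal]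
    exact add_tsub_cancel_of_le (hle v (mem_filter.1 hv).2.2)
  rw [MvPowerSeries.coeff_mul, ← sum_subset hsub, sum_image hφ.injOn]
  · refine sum_congr rfl fun v hv => ?_
    have : HasType (Finsupp.single v (s.2 : ℕ)) {s} :=
      hasType_singleton_iff.2 ⟨v, (mem_filter.1 hv).2.1, rfl⟩
    simp only [powerSum, M, φ, coeff_monomialSeries, if_pos this, one_mul]
  · rintro ⟨x, y⟩ hx hnot
    simp only [powerSum, M, coeff_monomialSeries]
    rw [if_neg, zero_mul]
    intro h
    obtain ⟨v, hv, rfl⟩ := hasType_singleton_iff.1 h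
    rw [HasAntidiagonal.mem_antidiagonal] at hx
    apply hnot
    have hm : (s.2 : ℕ) ≤ a v := by
      rw [← hx]
      simp
    refine mem_image.2 ⟨v, mem_filter.2 ⟨?_, hv, hm⟩, ?_⟩
    · exact Finsupp.mem_support_iff.2 (lt_of_lt_of_le s.2.pos hm).ne'
    · refine Prod.ext rfl ?_
      simp only [φ]
      rw [← hx]
      exact add_tsub_cancel_left _ _

/-- The product of the power sums attached to the stacks of `τ`. -/
noncomputable def powerSumProd (τ : StackPartition) : PLambda := (τ.map powerSum).prod

theorem powerSumProd_cons (s : Stack) (τ : StackPartition) :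
    powerSumProd (s ::ₘ τ) = powerSum s * powerSumProd τ := by
  simp [powerSumProd]

theorem coeff_powerSumProd_cons (s : Stack) (τ : StackPartition) (a : Var →₀ ℕ) :
    MvPowerSeries.coeff a (powerSumProd (s ::ₘ τ) : Series) =
      ∑ v ∈ a.support with v.1 = s.1 ∧ (s.2 : ℕ) ≤ a v,
        MvPowerSeries.coeff (a - Finsupp.single v (s.2 : ℕ)) (powerSumProd τ : Series) := by
  rw [powerSumProd_cons, MulMemClass.coe_mul, coeff_powerSum_mul]

theorem coeff_powerSumProd_zero (a : Var →₀ ℕ) :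
    MvPowerSeries.coeff a (powerSumProd 0 : Series) = if a = 0 then 1 else 0 := by
  classical
  rw [powerSumProd, Multiset.map_zero, Multiset.prod_zero, OneMemClass.coe_one,
    MvPowerSeries.coeff_one]

theorem coeff_powerSumProd_nonneg (τ : StackPartition) (a : Var →₀ ℕ) :
    0 ≤ MvPowerSeries.coeff a (powerSumProd τ : Series) := by
  induction τ using Multiset.induction_on generalizing a with
  | empty =>
    rw [coeff_powerSumProd_zero]
    split_ifs <;> norm_num
  | cons s τ ih =>
    rw [coeff_powerSumProd_cons]
    exact sum_nonneg fun v _ => ih _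

theorem support_tsub_single_self (a : Var →₀ ℕ) (v : Var) :
    (a - Finsupp.single v (a v)).support = a.support.erase v := by
  classical
  ext w
  by_cases h : w = v
  · subst h; simp
  · simp [Finsupp.single_eq_of_ne h, h]

theorem HasType.exists_tsub {a : Var →₀ ℕ} {s : Stack} {τ : StackPartition}
    (h : HasType a (s ::ₘ τ)) :
    ∃ v ∈ a.support, v.1 = s.1 ∧ a v = s.2 ∧ HasType (a - Finsupp.single v (s.2 : ℕ)) τ := by
  classical
  have hs : (s.1, (s.2 : ℕ)) ∈ a.support.val.map (fun v => (v.1, a v)) := by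
    rw [h]
    simp
  obtain ⟨v, hv, hvs⟩ := Multiset.mem_map.1 hs
  simp only [Prod.mk.injEq] at hvs
  refine ⟨v, hv, hvs.1, hvs.2, ?_⟩
  obtain ⟨σ, hσ⟩ := exists_hasType (a - Finsupp.single v (s.2 : ℕ))
  have hle : Finsupp.single v (s.2 : ℕ) ≤ a := Finsupp.single_le_iff.2 hvs.2.ge
  have h2 := hσ.add_single (v := v) (by simp [hvs.2]) s.2
  rw [tsub_add_cancel_of_le hle, hvs.1] at h2
  have h3 := hasType_injective h h2
  rw [(Multiset.cons_inj_right s).1 h3]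
  exact hσ

theorem coeff_powerSumProd_pos {τ : StackPartition} {a : Var →₀ ℕ} (h : HasType a τ) :
    0 < MvPowerSeries.coeff a (powerSumProd τ : Series) := by
  induction τ using Multiset.induction_on generalizing a with
  | empty =>
    have ha : a = 0 := by
      rw [← Finsupp.support_eq_empty, ← card_eq_zero, h.card_support, Multiset.card_zero]
    rw [coeff_powerSumProd_zero, if_pos ha]
    norm_num
  | cons s τ ih =>
    rw [coeff_powerSumProd_cons]
    obtain ⟨v, hv, h1, h2, h3⟩ := h.exists_tsub
    exact sum_pos' (fun v _ => coeff_powerSumProd_nonneg _ _)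
      ⟨v, mem_filter.2 ⟨hv, h1, h2.ge⟩, ih h3⟩

/-- Triangularity: each factor of the product either brings in a new variable or raises the exponent
of one already present. The number of variables reaches the number of stacks only if nothing merges,
and then the exponents are those of `τ`. -/
theorem card_support_le_and_hasType {τ : StackPartition} {a : Var →₀ ℕ}
    (h : MvPowerSeries.coeff a (powerSumProd τ : Series) ≠ 0) :
    #a.support ≤ Multiset.card τ ∧ (#a.support = Multiset.card τ → HasType a τ) := by
  classical
  induction τ using Multiset.induction_on generalizing a with
  | empty =>
    rw [coeff_powerSumProd_zero] at h
    obtain rfl : a = 0 := by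
      by_contra h'
      exact h (if_neg h')
    exact ⟨by simp, fun _ => hasType_zero⟩
  | cons s τ ih =>
    rw [coeff_powerSumProd_cons] at h
    obtain ⟨v, hv, hne⟩ := exists_ne_zero_of_sum_ne_zero h
    simp only [mem_filter] at hv
    obtain ⟨hva, hvs, hm⟩ := hv
    obtain ⟨h1, h2⟩ := ih hne
    rw [Multiset.card_cons]
    have hle : Finsupp.single v (s.2 : ℕ) ≤ a := Finsupp.single_le_iff.2 hm
    rcases hm.eq_or_lt with hm | hm
    · have hc : #(a - Finsupp.single v (s.2 : ℕ)).support + 1 = #a.support := by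
        rw [hm, support_tsub_single_self, card_erase_add_one hva]
      refine ⟨by omega, fun h => ?_⟩
      have h3 := (h2 (by omega)).add_single (v := v) (by simp [hm]) s.2
      rwa [tsub_add_cancel_of_le hle, hvs] at h3
    · have hsup : a.support ⊆ (a - Finsupp.single v (s.2 : ℕ)).support := by
        intro w hw
        by_cases hwv : w = v
        · subst hwv
          simp only [Finsupp.mem_support_iff, Finsupp.tsub_apply, Finsupp.single_eq_same]
          omega
        · simpa [Finsupp.single_eq_of_ne hwv] using hw
      have := card_le_card hsup
      exact ⟨by omega, fun h => by omega⟩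

/-- Peels off the monomials with the most variables: subtracting suitable multiples of power sum
products kills that layer, and by triangularity introduces no monomials in more variables. -/
theorem mem_adjoin_of_coeff_eq_zero (n : ℕ) (f : PLambda)
    (hf : ∀ a : Var →₀ ℕ, n ≤ #a.support → MvPowerSeries.coeff a (f : Series) = 0) :
    f ∈ Algebra.adjoin ℚ (Set.range powerSum) := by
  classical
  induction n generalizing f with
  | zero =>
    have : f = 0 := Subtype.ext (MvPowerSeries.ext fun a => hf a (Nat.zero_le _))
    rw [this]
    exact zero_mem _
  | succ n ih =>
    obtain ⟨N, hN⟩ := f.2.1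
    choose r hr using exists_monomial_hasType
    let T : Finset StackPartition :=
      {τ ∈ (range (N + 1)).biUnion stackPartitions | Multiset.card τ = n}
    -- Chosen so that `c τ • powerSumProd τ` matches `f` on monomials of type `τ`; the denominator
    -- is positive.
    let c : StackPartition → ℚ := fun τ => MvPowerSeries.coeff (r τ) (f : Series) /
      MvPowerSeries.coeff (r τ) (powerSumProd τ : Series)
    let g : PLambda := ∑ τ ∈ T, c τ • powerSumProd τ
    have hg : g ∈ Algebra.adjoin ℚ (Set.range powerSum) := by
      refine sum_mem fun τ _ => Subalgebra.smul_mem _ ?_ _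
      refine Subalgebra.multiset_prod_mem _ fun x hx => ?_
      obtain ⟨s, -, rfl⟩ := Multiset.mem_map.1 hx
      exact Algebra.subset_adjoin ⟨s, rfl⟩
    have hcoeff : ∀ a, MvPowerSeries.coeff a (g : Series) =
        ∑ τ ∈ T, c τ * MvPowerSeries.coeff a (powerSumProd τ : Series) := by
      intro a
      simp [g]
    rw [← sub_add_cancel f g]
    refine add_mem (ih _ fun a ha => ?_) hg
    rw [AddSubgroupClass.coe_sub, map_sub, sub_eq_zero, hcoeff]
    rcases ha.eq_or_lt with ha | ha
    · obtain ⟨τ, hτ⟩ := exists_hasType a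
      have hzero : ∀ σ ∈ T, σ ≠ τ →
          c σ * MvPowerSeries.coeff a (powerSumProd σ : Series) = 0 := by
        intro σ hσ hne
        have hcard := (mem_filter.1 hσ).2
        rw [mul_eq_zero]
        right
        by_contra h
        exact hne (hasType_injective
          ((card_support_le_and_hasType h).2 (ha.symm.trans hcard.symm)) hτ)
      have hpos := coeff_powerSumProd_pos (hr τ)
      rw [sum_eq_single τ hzero]
      · simp only [c]
        rw [coeff_eq_of_hasType f.2.2 hτ (hr τ),
          coeff_eq_of_hasType (powerSumProd τ).2.2 hτ (hr τ), div_mul_cancel₀ _ hpos.ne']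
      -- A type missing from `T` has degree above the bound `N`, so `f` vanishes there.
      · intro hT
        have hlt : N < monomialDegree (r τ) := by
          by_contra! hle
          rw [(hr τ).monomialDegree_eq] at hle
          refine hT (mem_filter.2 ⟨mem_biUnion.2 ⟨τ.size, mem_range.2 (by omega), ?_⟩, ?_⟩)
          · simp [stackPartitions]
          · rw [← hτ.card_support, ha]
        simp only [c]
        rw [hN _ hlt, zero_div, zero_mul]
    · rw [hf a ha, sum_eq_zero]
      intro σ hσ
      have hcard := (mem_filter.1 hσ).2
      rw [mul_eq_zero]
      right
      by_contra h
      have := (card_support_le_and_hasType h).1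
      omega

theorem adjoin_powerSum : Algebra.adjoin ℚ (Set.range powerSum) = ⊤ := by
  rw [eq_top_iff]
  intro f _
  obtain ⟨N, hN⟩ := f.2.1
  refine mem_adjoin_of_coeff_eq_zero (N + 1) f fun a ha => hN a ?_
  obtain ⟨τ, hτ⟩ := exists_hasType a
  have := τ.length_le_size
  rw [hτ.monomialDegree_eq]
  rw [hτ.card_support] at ha
  simp only [StackPartition.length] at this
  omega

theorem aeval_powerSum_monomial (m : Stack →₀ ℕ) (c : ℚ) :
    MvPolynomial.aeval powerSum (MvPolynomial.monomial m c) =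
      c • powerSumProd (Finsupp.toMultiset m) := by
  rw [MvPolynomial.aeval_monomial, powerSumProd, Finsupp.toMultiset_map, Finsupp.prod_toMultiset,
    Finsupp.prod_mapDomain_index (by simp) (by simp [pow_add]), Algebra.smul_def]

/-- In a nonzero relation, take a term with the most factors: by triangularity no other term reaches
a monomial of its type, so nothing can cancel it. -/
theorem algebraicIndependent_powerSum : AlgebraicIndependent ℚ powerSum := by
  classical
  rw [algebraicIndependent_iff]
  intro F hF
  by_contra hne
  obtain ⟨m, hm, hmax⟩ := exists_max_image F.support
    (fun m => Multiset.card (Finsupp.toMultiset m)) (MvPolynomial.support_nonempty.2 hne)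
  obtain ⟨a, ha⟩ := exists_monomial_hasType (Finsupp.toMultiset m)
  have h0 : MvPowerSeries.coeff a (MvPolynomial.aeval powerSum F : PLambda).1 = 0 := by
    rw [hF]; simp
  have h1 : MvPowerSeries.coeff a (MvPolynomial.aeval powerSum F : PLambda).1 =
      ∑ k ∈ F.support, F.coeff k *
        MvPowerSeries.coeff a (powerSumProd (Finsupp.toMultiset k) : Series) := by
    conv_lhs => rw [F.as_sum]
    simp only [map_sum, aeval_powerSum_monomial]
    simp
  rw [h1, sum_eq_single m] at h0
  · exact (mul_ne_zero (MvPolynomial.mem_support_iff.1 hm) (coeff_powerSumProd_pos ha).ne') h0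
  · intro k hk hkm
    rw [mul_eq_zero]
    right
    by_contra h
    obtain ⟨h2, h3⟩ := card_support_le_and_hasType h
    rw [ha.card_support] at h2 h3
    have := hasType_injective (h3 (le_antisymm h2 (hmax k hk))) ha
    exact hkm (Multiset.toFinsupp.symm.injective this)
  · exact fun h => absurd hm h

/-- Polysymmetric functions are the polynomials in the power sums. -/
noncomputable def powerSumEquiv : MvPolynomial Stack ℚ ≃ₐ[ℚ] PLambda :=
  AlgEquiv.ofBijective (MvPolynomial.aeval powerSum)
    ⟨algebraicIndependent_powerSum, by
      rw [← AlgHom.range_eq_top, ← Algebra.adjoin_range_eq_range_aeval, adjoin_powerSum]⟩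

/-- The endomorphism of `PΛ` that negates every power sum. -/
noncomputable def negPowerSum : PLambda →ₐ[ℚ] PLambda :=
  (MvPolynomial.aeval fun s => -powerSum s).comp powerSumEquiv.symm.toAlgHom

theorem negPowerSum_powerSum (s : Stack) : negPowerSum (powerSum s) = -powerSum s := by
  have : powerSumEquiv (MvPolynomial.X s) = powerSum s := MvPolynomial.aeval_X _ _
  have h : powerSumEquiv.symm (powerSum s) = MvPolynomial.X s := by
    rw [← this, AlgEquiv.symm_apply_apply]
  simp [negPowerSum, h]

/-- Ring homomorphisms between ℚ-algebras are automatically ℚ-linear, so agreement on algebra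
generators suffices. -/
theorem ringHom_ext_powerSum {φ ψ : PLambda →+* PLambda}
    (h : ∀ s, φ (powerSum s) = ψ (powerSum s)) : φ = ψ := by
  have : φ.toRatAlgHom = ψ.toRatAlgHom := by
    refine AlgHom.ext_of_adjoin_eq_top adjoin_powerSum ?_
    rintro _ ⟨s, rfl⟩
    exact h s
  ext1 x
  exact DFunLike.congr_fun this x

theorem powerSubst_powerSum (m : ℕ+) (s : Stack) :
    powerSubst m (powerSum s) = powerSum (s.1, m * s.2) := by
  classical
  refine Subtype.ext (MvPowerSeries.ext fun a => ?_)
  simp only [powerSubst, powerSum, M, coeff_monomialSeries]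
  by_cases h : ∃ c : Var →₀ ℕ, a = (m : ℕ) • c
  · obtain ⟨c, rfl⟩ := h
    rw [MvPowerSeries.coeff_expand_smul, coeff_monomialSeries]
    congr 1
    simp only [hasType_singleton_iff, PNat.mul_coe, ← smul_eq_mul (m : ℕ),
      ← Finsupp.smul_single, (smul_right_injective (Var →₀ ℕ) m.ne_zero).eq_iff]
  · rw [if_neg]
    · by_cases hd : ∀ v, (m : ℕ) ∣ a v
      · choose b hb using hd
        refine absurd ⟨a.mapRange (fun k => k / (m : ℕ)) (Nat.zero_div _), ?_⟩ h
        ext v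
        simp [hb v]
      · push Not at hd
        obtain ⟨v, hv⟩ := hd
        exact MvPowerSeries.coeff_expand_of_not_dvd _ _ _ hv
    · rw [hasType_singleton_iff]
      rintro ⟨v, -, rfl⟩
      exact h ⟨Finsupp.single v s.2, by simp [Finsupp.smul_single]⟩

/-- Substitution of `x^m` for `x`, as an algebra endomorphism of `PΛ`. -/
noncomputable def powerSubstHom (m : ℕ+) : PLambda →ₐ[ℚ] PLambda :=
  ((MvPowerSeries.expand (m : ℕ) m.ne_zero).comp PLambda.val).codRestrict PLambda
    fun f => expand_mem m f.2

theorem powerSubstHom_apply (m : ℕ+) (f : PLambda) : powerSubstHom m f = powerSubst m f := rfl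

/-! ### Newton's identities -/

/-- The degree `n` part of `∏_v ∑_k g(k) x_v^k`. -/
noncomputable def prodSeries (g : ℕ → ℚ) (n : ℕ) : Series :=
  fun a => if monomialDegree a = n then a.prod fun _ k => g k else 0

theorem coeff_prodSeries (g : ℕ → ℚ) (n : ℕ) (a : Var →₀ ℕ) :
    MvPowerSeries.coeff a (prodSeries g n) =
      if monomialDegree a = n then a.prod fun _ k => g k else 0 := rfl

/-- The stacks `k^r` with `k r ≤ n`. -/
def stacksLE (n : ℕ+) : Finset Stack :=
  {s ∈ Icc 1 n ×ˢ Icc 1 n | (s.1 : ℕ) * s.2 ≤ n}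

theorem mem_stacksLE {n : ℕ+} {s : Stack} : s ∈ stacksLE n ↔ (s.1 : ℕ) * s.2 ≤ n := by
  simp only [stacksLE, mem_filter, mem_product, mem_Icc, one_le, true_and,
    and_iff_right_iff_imp, ← PNat.coe_le_coe]
  exact fun h => ⟨le_trans (Nat.le_mul_of_pos_right _ s.2.pos) h,
    le_trans (Nat.le_mul_of_pos_left _ s.1.pos) h⟩

/-- Since `g 0 = 1`, the product may run over all of `a.support` even when `v` drops out. -/
theorem prod_tsub_single (g : ℕ → ℚ) (hg : g 0 = 1) (a : Var →₀ ℕ) {v : Var}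
    (hv : v ∈ a.support) (r : ℕ) :
    (a - Finsupp.single v r).prod (fun _ k => g k) =
      g (a v - r) * ∏ w ∈ a.support.erase v, g (a w) := by
  rw [Finsupp.prod_of_support_subset _ (s := a.support)
    (Finsupp.support_mono (tsub_le_self)) _ (fun _ _ => hg), ← mul_prod_erase _ _ hv]
  congr 1
  · simp
  · refine prod_congr rfl fun w hw => ?_
    simp [Finsupp.single_eq_of_ne (ne_of_mem_erase hw)]

theorem sum_stacksLE_filter {n : ℕ+} {v : Var} {N : ℕ} (h : (v.1 : ℕ) * N ≤ n) (F : ℕ → ℚ) :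
    ∑ s ∈ stacksLE n with v.1 = s.1 ∧ (s.2 : ℕ) ≤ N, F s.2 = ∑ r ∈ Icc 1 N, F r := by
  refine sum_bij' (fun s _ => (s.2 : ℕ)) (fun r hr => (v.1, ⟨r, (mem_Icc.1 hr).1⟩)) ?_ ?_ ?_ ?_ ?_
  · intro s hs
    exact mem_Icc.2 ⟨s.2.pos, (mem_filter.1 hs).2.2⟩
  · intro r hr
    refine mem_filter.2 ⟨mem_stacksLE.2 ?_, rfl, (mem_Icc.1 hr).2⟩
    exact (Nat.mul_le_mul_left _ (mem_Icc.1 hr).2).trans h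
  · intro s hs
    exact Prod.ext (mem_filter.1 hs).2.1 rfl
  · intro r hr
    rfl
  · intro s hs
    rfl

/-- Newton's identity for the degree `n` part of `∏_v ∑_k g(k) x_v^k`. -/
theorem newton_prodSeries (g c : ℕ → ℚ) (hg : g 0 = 1)
    (hc : ∀ N : ℕ, ∑ r ∈ Icc 1 N, c r * g (N - r) = N * g N) (n : ℕ+) :
    ((n : ℕ) : ℚ) • prodSeries g n = ∑ s ∈ stacksLE n, (((s.1 : ℕ) : ℚ) * c s.2) •
      ((powerSum s : Series) * prodSeries g (n - s.1 * s.2)) := by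
  classical
  -- With G = ∑ g(k) x^k, the hypothesis `hc` says x G' = G · ∑_{r≥1} c(r) x^r. Applied to each
  -- variable of `a` it contributes `v.1 * a v` times the coefficient of `a`, and these weights add
  -- up to the degree `n`.
  ext a
  simp only [map_sum, map_smul, coeff_powerSum_mul, smul_eq_mul, mul_sum]
  have hdeg : ∀ v ∈ a.support, ∀ r : ℕ, r ≤ a v →
      monomialDegree (a - Finsupp.single v r) + v.1 * r = monomialDegree a := by
    intro v _ r hr
    have h1 : monomialDegree (Finsupp.single v r) = v.1 * r := by
      simp [monomialDegree, Finsupp.weight_single, mul_comm]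
    rw [← h1, ← monomialDegree_add, tsub_add_cancel_of_le (Finsupp.single_le_iff.2 hr)]
  by_cases ha : monomialDegree a = n
  · have hle : ∀ v ∈ a.support, (v.1 : ℕ) * a v ≤ n := by
      intro v hv
      have := hdeg v hv _ le_rfl
      omega
    have h1 : ∀ s ∈ stacksLE n, ∀ v ∈ {v ∈ a.support | v.1 = s.1 ∧ (s.2 : ℕ) ≤ a v},
        ((s.1 : ℕ) : ℚ) * c s.2 * MvPowerSeries.coeff (a - Finsupp.single v (s.2 : ℕ))
          (prodSeries g (n - s.1 * s.2)) =
        ((v.1 : ℕ) : ℚ) * (∏ w ∈ a.support.erase v, g (a w)) * (c s.2 * g (a v - s.2)) := by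
      intro s hs v hv
      obtain ⟨hva, hvs, hm⟩ := mem_filter.1 hv
      have := hdeg v hva _ hm
      rw [hvs] at this
      rw [coeff_prodSeries, if_pos (by omega), prod_tsub_single g hg a hva, hvs]
      ring
    rw [sum_congr rfl fun s hs => sum_congr rfl (h1 s hs)]
    simp only [sum_filter]
    rw [sum_comm]
    simp only [← sum_filter]
    have h2 : ∀ v ∈ a.support, ∑ s ∈ stacksLE n with v.1 = s.1 ∧ (s.2 : ℕ) ≤ a v,
        ((v.1 : ℕ) : ℚ) * (∏ w ∈ a.support.erase v, g (a w)) * (c s.2 * g (a v - s.2)) =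
        (((a v * (v.1 : ℕ) : ℕ)) : ℚ) * a.prod fun _ k => g k := by
      intro v hv
      rw [← mul_sum, sum_stacksLE_filter (hle v hv) (fun r => c r * g (a v - r)), hc,
        Finsupp.prod, ← mul_prod_erase _ _ hv]
      push_cast
      ring
    rw [sum_congr rfl h2, ← sum_mul, coeff_prodSeries, if_pos ha, ← Nat.cast_sum]
    congr 2
    rw [← ha, monomialDegree, Finsupp.weight_apply, Finsupp.sum]
    simp only [smul_eq_mul]
  · rw [coeff_prodSeries, if_neg ha, mul_zero, eq_comm]
    refine sum_eq_zero fun s hs => sum_eq_zero fun v hv => ?_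
    obtain ⟨hva, hvs, hm⟩ := mem_filter.1 hv
    have := hdeg v hva _ hm
    rw [hvs] at this
    -- This bound makes the truncated subtraction `n - s.1 * s.2` exact.
    have := mem_stacksLE.1 hs
    rw [coeff_prodSeries, if_neg (by omega), mul_zero]

theorem prodSeries_zero (g : ℕ → ℚ) : prodSeries g 0 = 1 := by
  classical
  ext a
  rw [coeff_prodSeries, MvPowerSeries.coeff_one]
  have : monomialDegree a = 0 ↔ a = 0 := by
    constructor
    · intro h
      obtain ⟨τ, hτ⟩ := exists_hasType a
      have h1 := τ.length_le_size
      rw [← hτ.monomialDegree_eq, h, StackPartition.length, ← hτ.card_support] at h1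
      simpa using h1
    · rintro rfl
      simp [monomialDegree]
  by_cases h : a = 0
  · subst h
    simp [this]
  · rw [if_neg (this.not.2 h), if_neg h]

/-- The degree `n` part of `∏_v (1 + x_v)`. -/
noncomputable def elemPart (n : ℕ) : PLambda := ∑ α ∈ ordinaryPartitions n, M α

/-- The degree `n` part of `∏_v (1 + x_v)⁻¹`. -/
noncomputable def homPart (n : ℕ) : PLambda := ∑ α ∈ stackPartitions n, α.sgn • M α

theorem mem_stackPartitions {n : ℕ} {τ : StackPartition} :
    τ ∈ stackPartitions n ↔ τ.size = n := by
  simp [stackPartitions]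

theorem sum_coeff_M {S : Finset StackPartition} (w : StackPartition → ℚ) {a : Var →₀ ℕ}
    {τ : StackPartition} (h : HasType a τ) [Decidable (τ ∈ S)] :
    MvPowerSeries.coeff a ((∑ α ∈ S, w α • M α : PLambda) : Series) =
      if τ ∈ S then w τ else 0 := by
  classical
  have h1 : ∀ α, HasType a α ↔ α = τ :=
    fun α => ⟨fun h' => hasType_injective h' h, fun h' => h' ▸ h⟩
  simp [M, coeff_monomialSeries, h1]

theorem HasType.prod_eq {a : Var →₀ ℕ} {τ : StackPartition} (h : HasType a τ) (g : ℕ → ℚ) :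
    (a.prod fun _ k => g k) = (τ.map fun s => g s.2).prod := by
  have := congrArg (fun s : Multiset (ℕ+ × ℕ) => (s.map fun p => g p.2).prod) h
  simp only [Multiset.map_map, Function.comp_def] at this
  exact this

theorem coe_homPart (n : ℕ) : (homPart n : Series) = prodSeries (fun k => (-1) ^ k) n := by
  classical
  ext a
  obtain ⟨τ, hτ⟩ := exists_hasType a
  rw [homPart, sum_coeff_M _ hτ, coeff_prodSeries, hτ.monomialDegree_eq, hτ.prod_eq]
  simp only [mem_stackPartitions, StackPartition.sgn, StackPartition.area]
  congr 1
  clear hτ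
  induction τ using Multiset.induction_on with
  | empty => simp
  | cons s τ ih =>
    simp only [Multiset.map_cons, Multiset.sum_cons, Multiset.prod_cons, pow_add, ih]

theorem coe_elemPart (n : ℕ) :
    (elemPart n : Series) = prodSeries (fun k => if k ≤ 1 then 1 else 0) n := by
  classical
  ext a
  obtain ⟨τ, hτ⟩ := exists_hasType a
  have h1 : elemPart n = ∑ α ∈ ordinaryPartitions n, (1 : ℚ) • M α := by simp [elemPart]
  rw [h1, sum_coeff_M _ hτ, coeff_prodSeries, hτ.monomialDegree_eq, hτ.prod_eq]
  simp only [ordinaryPartitions, mem_filter, mem_stackPartitions, ite_and]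
  congr 1
  by_cases h : τ.IsOrdinary
  · rw [if_pos h, eq_comm]
    refine Multiset.prod_eq_one fun x hx => ?_
    obtain ⟨s, hs, rfl⟩ := Multiset.mem_map.1 hx
    simp [h s hs]
  · rw [if_neg h, eq_comm, Multiset.prod_eq_zero_iff]
    simp only [StackPartition.IsOrdinary, not_forall] at h
    obtain ⟨s, hs, hne⟩ := h
    refine Multiset.mem_map.2 ⟨s, hs, if_neg ?_⟩
    intro hle
    exact hne (le_antisymm (PNat.coe_le_coe _ _ |>.1 hle) (one_le))

/-- Here G = 1 + x and x G'/G = ∑_{r≥1} -(-1)^r x^r. For G = 1/(1 + x), in `newton_homPart`, the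
coefficients are the opposite ones. -/
theorem newton_elemPart (n : ℕ+) :
    ((n : ℕ) : ℚ) • elemPart n = ∑ s ∈ stacksLE n,
      (((s.1 : ℕ) : ℚ) * -(-1) ^ (s.2 : ℕ)) • (powerSum s * elemPart (n - s.1 * s.2)) := by
  apply Subtype.ext
  have h := newton_prodSeries (fun k => if k ≤ 1 then 1 else 0) (fun r => -(-1) ^ r)
    (by simp) ?_ n
  · simpa only [coe_elemPart, AddSubmonoidClass.coe_finsetSum, SetLike.val_smul,
      MulMemClass.coe_mul] using h
  · intro N
    rcases N with _ | _ | N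
    · simp
    · simp
    -- Only the two top values of `r` leave an exponent at most 1, and their terms cancel.
    · rw [sum_Icc_succ_top (by omega), sum_Icc_succ_top (by omega), sum_eq_zero]
      · simp [pow_succ]
      · intro r hr
        rw [mem_Icc] at hr
        rw [if_neg (by omega), mul_zero]

theorem newton_homPart (n : ℕ+) :
    ((n : ℕ) : ℚ) • homPart n = ∑ s ∈ stacksLE n,
      (((s.1 : ℕ) : ℚ) * (-1) ^ (s.2 : ℕ)) • (powerSum s * homPart (n - s.1 * s.2)) := by
  apply Subtype.ext
  have h := newton_prodSeries (fun k => (-1) ^ k) (fun r => (-1) ^ r) (by simp) ?_ n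
  · simpa only [coe_homPart, AddSubmonoidClass.coe_finsetSum, SetLike.val_smul,
      MulMemClass.coe_mul] using h
  · intro N
    rw [sum_congr rfl (g := fun _ => (-1 : ℚ) ^ N)]
    · simp
    · intro r hr
      rw [← pow_add, Nat.add_sub_cancel' (mem_Icc.1 hr).2]

theorem newton_elemPart_powerSubst (m n : ℕ+) :
    ((n : ℕ) : ℚ) • powerSubstHom m (elemPart n) = ∑ s ∈ stacksLE n,
      (((s.1 : ℕ) : ℚ) * -(-1) ^ (s.2 : ℕ)) •
        (powerSum (s.1, m * s.2) * powerSubstHom m (elemPart (n - s.1 * s.2))) := by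
  have h := congrArg (powerSubstHom m) (newton_elemPart n)
  simpa only [map_sum, map_smul, map_mul, powerSubstHom_apply m (powerSum _),
    powerSubst_powerSum] using h

theorem newton_homPart_powerSubst (m n : ℕ+) :
    ((n : ℕ) : ℚ) • powerSubstHom m (homPart n) = ∑ s ∈ stacksLE n,
      (((s.1 : ℕ) : ℚ) * (-1) ^ (s.2 : ℕ)) •
        (powerSum (s.1, m * s.2) * powerSubstHom m (homPart (n - s.1 * s.2))) := by
  have h := congrArg (powerSubstHom m) (newton_homPart n)
  simpa only [map_sum, map_smul, map_mul, powerSubstHom_apply m (powerSum _),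
    powerSubst_powerSum] using h

theorem elemPart_zero : elemPart 0 = 1 :=
  Subtype.ext ((coe_elemPart 0).trans (prodSeries_zero _))

theorem homPart_zero : homPart 0 = 1 :=
  Subtype.ext ((coe_homPart 0).trans (prodSeries_zero _))

theorem neg_smul_neg_mul (c : ℚ) (x y : PLambda) : -c • (-x * y) = c • (x * y) := by
  have : -x * y = -(x * y) := neg_mul x y
  rw [this, smul_neg, neg_smul, neg_neg]

/-! ### Existence, uniqueness and properties of Ω -/

/-- Negating the power sums turns the Newton recursion for E⁺ into that for H⁺. Both start at 1, and
division by `n` is possible over ℚ. -/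
theorem isOmega_of_powerSum {Ω : PLambda →+* PLambda}
    (h : ∀ s, Ω (powerSum s) = -powerSum s) : IsOmega Ω := by
  intro d m
  suffices ∀ n, Ω (powerSubstHom m (elemPart n)) = powerSubstHom m (homPart n) from this d
  intro n
  induction n using Nat.strong_induction_on with
  | _ n ih =>
  rcases n.eq_zero_or_pos with rfl | hn
  · simp [elemPart_zero, homPart_zero]
  have hn0 : (n : ℚ) ≠ 0 := by exact_mod_cast hn.ne'
  have h1 := congrArg Ω (newton_elemPart_powerSubst m ⟨n, hn⟩)
  have h2 := newton_homPart_powerSubst m ⟨n, hn⟩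
  simp only [map_sum, map_rat_smul, map_mul, PNat.mk_coe] at h1 h2
  refine smul_right_injective PLambda hn0 ?_
  simp only
  rw [h1, h2]
  refine sum_congr rfl fun s _ => ?_
  have : 0 < (s.1 : ℕ) * s.2 := Nat.mul_pos s.1.pos s.2.pos
  rw [h, ih _ (by omega), mul_neg, neg_smul_neg_mul]

/-- Strong induction on `d`, for all `m` at once because p_{k,mr} occurs in the recursion. The image
of the recursion for E⁺ is compared with that for H⁺: terms with k < d agree by induction, leaving
only the stack d^1. -/
theorem IsOmega.map_powerSum {Ω : PLambda →+* PLambda} (h : IsOmega Ω) (s : Stack) :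
    Ω (powerSum s) = -powerSum s := by
  obtain ⟨d, m⟩ := s
  induction d using PNat.strongInductionOn generalizing m with
  | _ d ih =>
  have hn : ∀ n, Ω (powerSubstHom m (elemPart n)) = powerSubstHom m (homPart n) := by
    intro n
    rcases n.eq_zero_or_pos with rfl | hn
    · simp [elemPart_zero, homPart_zero]
    · exact h ⟨n, hn⟩ m
  have h1 := congrArg Ω (newton_elemPart_powerSubst m d)
  have h2 := newton_homPart_powerSubst m d
  simp only [map_sum, map_rat_smul, map_mul, hn] at h1
  rw [h1, ← sub_eq_zero, ← sum_sub_distrib, sum_eq_single (d, 1)] at h2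
  · have hd : ((d : ℕ) : ℚ) ≠ 0 := by exact_mod_cast d.ne_zero
    have h3 : ((d : ℕ) : ℚ) • (Ω (powerSum (d, m)) + powerSum (d, m)) = 0 := by
      rw [← h2]
      simp [homPart_zero]
    exact eq_neg_of_add_eq_zero_left ((smul_eq_zero_iff_right hd).1 h3)
  · rintro ⟨k, r⟩ hs hne
    have hkr := mem_stacksLE.1 hs
    -- If `k ≥ d`, then `k * r ≤ d` forces `r = 1` and `k = d`, the excluded stack.
    have hk : k < d := by
      rw [← PNat.coe_lt_coe]
      by_contra! hdk
      have hr : r = 1 := by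
        by_contra hr
        have hr2 : 2 ≤ (r : ℕ) := by
          have := r.pos
          have : (r : ℕ) ≠ 1 := fun e => hr (PNat.coe_eq_one_iff.1 e)
          omega
        have hd := d.pos
        simp only at hkr
        nlinarith
      subst hr
      simp only [PNat.one_coe, mul_one] at hkr
      exact hne (Prod.ext (PNat.coe_injective (le_antisymm hkr hdk)) rfl)
    simp only
    rw [ih k hk, mul_neg, neg_smul_neg_mul, sub_self]
  · intro hd
    exact absurd (mem_stacksLE.2 (by simp)) hd

/-- P_{d^m} is a ℚ-linear combination of single power sums, so it is negated with them. -/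
theorem IsOmega.map_PStack {Ω : PLambda →+* PLambda} (h : IsOmega Ω) (s : Stack) :
    Ω (PStack s) = -PStack s := by
  have hP : PStack s = ∑ k ∈ (Icc (1 : ℕ+) s.1).filter (fun k : ℕ+ => (k : ℕ) ∣ (s.1 : ℕ)),
      ((k : ℕ) : ℚ) • powerSum (k, s.2 * PNat.divExact s.1 k) := by
    rw [PStack, ← powerSubstHom_apply, P, map_sum]
    refine sum_congr rfl fun k _ => ?_
    rw [map_smul]
    exact congrArg _ (powerSubst_powerSum s.2 _)
  simp only [hP, map_sum, map_rat_smul, h.map_powerSum, smul_neg, sum_neg_distrib]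

theorem IsOmega.map_PPartition {Ω : PLambda →+* PLambda} (h : IsOmega Ω) (τ : StackPartition) :
    Ω (PPartition τ) = (-1) ^ τ.length * PPartition τ := by
  simp only [PPartition, map_multiset_prod, Multiset.map_map, Function.comp_def, h.map_PStack]
  have h1 := Multiset.prod_map_neg (τ.map PStack)
  rwa [Multiset.map_map, Multiset.card_map] at h1

theorem IsOmega.involutive {Ω : PLambda →+* PLambda} (h : IsOmega Ω) :
    Function.Involutive Ω := by
  have : Ω.comp Ω = RingHom.id PLambda := ringHom_ext_powerSum fun s => by
    simp [h.map_powerSum]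
  exact fun x => DFunLike.congr_fun this x

end PolySym

theorem mainTheorem2 :
    (∃! Ω : PolySym.PLambda →+* PolySym.PLambda, PolySym.IsOmega Ω) ∧
      ∀ Ω : PolySym.PLambda →+* PolySym.PLambda, PolySym.IsOmega Ω →
        Function.Involutive Ω ∧
          ∀ τ : PolySym.StackPartition,
            Ω (PolySym.PPartition τ) = (-1) ^ τ.length * PolySym.PPartition τ := by
  refine ⟨⟨PolySym.negPowerSum.toRingHom,
    PolySym.isOmega_of_powerSum PolySym.negPowerSum_powerSum, fun Ω hΩ => ?_⟩,
    fun Ω hΩ => ⟨hΩ.involutive, hΩ.map_PPartition⟩⟩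
  refine PolySym.ringHom_ext_powerSum fun s => ?_
  rw [hΩ.map_powerSum]
  exact (PolySym.negPowerSum_powerSum s).symm
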